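/- For $\mathbf a\in\mathbb C^2$, $\mathbf b\in\mathbb C^2$, $\mathbf c\in\mathbb C^3$ call $\mathbf a\otimes\mathbf b\otimes\mathbf c$ a decomposable tensor. The rank $\mathrm{rk}(T)$ of $T\in\mathbb C^2\otimes\mathbb C^2\otimes\mathbb C^3$ is the least $r$ such that $T$ is a sum of $r$ decomposable tensors, and the decomposition locus of $T$ is $$\mathcal D_T=\{(\mathbf a,\mathbf b,\mathbf c)\in\mathbb C^2\times\mathbb C^2\times\mathbb C^3:\ \mathrm{rk}(T-\lambda\,\mathbf a\otimes\mathbf b\otimes\mathbf c)=\mathrm{rk}(T)-1\text{ for some }\lambda\in\mathbb C\}.$$ Let $\mathcal O_7,\mathcal O_8$ be the $\mathrm{GL}_2\times\mathrm{GL}_2\times\mathrm{GL}_3$-orbits of $$T_7=\mathbf e_1\otimes(\mathbf e_1\otimes\mathbf e_1+\mathbf e_2\otimes\mathbf e_3)+\mathbf e_2\otimes\mathbf e_1\otimes\mathbf e_2,\qquad T_8=\mathbf e_1\otimes(\mathbf e_1\otimes\mathbf e_1+\mathbf e_2\otimes\mathbf e_2)+\mathbf e_2\otimes(\mathbf e_1\otimes\mathbf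 e_2+\mathbf e_2\otimes\mathbf e_3).$$ Let $X_{22}\subset\mathbb P(\mathbb C^2\otimes\mathbb C^2)$ be the Segre surface of classes of nonzero tensors $\mathbf a\otimes\mathbf b$. A conic section of $X_{22}$ is a plane section $\mathcal C=\{[\mathbf a\otimes\mathbf b]\in X_{22}: C(\mathbf a\otimes\mathbf b)=0\}$ with $0\ne C\in(\mathbb C^2\otimes\mathbb C^2)^\vee$ (it may be reducible). Write $\nu(\mathcal C\times\mathbb P^2)=\{[\mathbf a\otimes\mathbf b\otimes\mathbf c]: [\mathbf a\otimes\mathbf b]\in\mathcal C,\ [\mathbf c]\in\mathbb P^2\}$ and $\langle\cdot\rangle$ for linear span. Let $\mathrm{Sub}_{m_1m_2m_3}$ be the set of tensors in $\mathbb C^2\otimes\mathbb C^2\otimes\mathbb C^3$ that lie in $A_1\otimes A_2\otimes A_3$ for some linear subspaces $A_i$ with $\dim A_i=m_i$. For $S\in\mathrm{Sub}_{222}$, $H_{222}(S)$ denotes Cayley's $2\times2\times2$ hyperdeterminant of $S$ in linear coordinates of some such $A_1\otimes A_2\otimes A_3\cong\mathbb C^2\otimes\mathbb C^2\otimes\mathbb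 C^2$; whether it vanishes does not depend on the choices. Proposition. Let $T\in\mathcal O_7\cup\mathcal O_8$. There is a conic section $\mathcal C$ of $X_{22}$ with $[T]\in\langle\nu(\mathcal C\times\mathbb P^2)\rangle$. For every such $\mathcal C$, with defining form $C$, one has $(\mathbf a,\mathbf b,\mathbf c)\in\mathcal D_T$ if and only if $C(\mathbf a\otimes\mathbf b)=0$ and, with $P=\mathbf a\otimes\mathbf b\otimes\mathbf c$, there is $\lambda\in\mathbb C$ such that either $T-\lambda P\in\mathrm{Sub}_{222}$ with $H_{222}(T-\lambda P)\neq0$, or $T-\lambda P\in\mathrm{Sub}_{122}\cup\mathrm{Sub}_{212}$. -/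

import Mathlib

open scoped TensorProduct

noncomputable section

/-- The space `ℂ^{n₁} ⊗ ℂ^{n₂} ⊗ ℂ^{n₃}`. -/
abbrev Tensor3 (n₁ n₂ n₃ : ℕ) : Type :=
  ((Fin n₁ → ℂ) ⊗[ℂ] (Fin n₂ → ℂ)) ⊗[ℂ] (Fin n₃ → ℂ)

/-- The tensor `a ⊗ b ⊗ c`. -/
def pureTensor {n₁ n₂ n₃ : ℕ} (a : Fin n₁ → ℂ) (b : Fin n₂ → ℂ) (c : Fin n₃ → ℂ) :
    Tensor3 n₁ n₂ n₃ :=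
  (a ⊗ₜ[ℂ] b) ⊗ₜ[ℂ] c

/-- The tensor rank: the least `r` such that `T` is a sum of `r` tensors `a ⊗ b ⊗ c`. -/
def tensorRank {n₁ n₂ n₃ : ℕ} (T : Tensor3 n₁ n₂ n₃) : ℕ :=
  sInf {r : ℕ | ∃ (a : Fin r → Fin n₁ → ℂ) (b : Fin r → Fin n₂ → ℂ) (c : Fin r → Fin n₃ → ℂ),
    T = ∑ i, pureTensor (a i) (b i) (c i)}

/-- The decomposition locus: the triples `(a, b, c)` such that `rk (T - λ a ⊗ b ⊗ c) = rk T - 1`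
for some `λ`. -/
def decompositionLocus {n₁ n₂ n₃ : ℕ} (T : Tensor3 n₁ n₂ n₃) :
    Set ((Fin n₁ → ℂ) × (Fin n₂ → ℂ) × (Fin n₃ → ℂ)) :=
  {p | ∃ l : ℂ, tensorRank (T - l • pureTensor p.1 p.2.1 p.2.2) + 1 = tensorRank T}

/-- The linear map `f₁ ⊗ f₂ ⊗ f₃`. -/
def mapTensor {m₁ m₂ m₃ n₁ n₂ n₃ : ℕ} (f₁ : (Fin m₁ → ℂ) →ₗ[ℂ] (Fin n₁ → ℂ))
    (f₂ : (Fin m₂ → ℂ) →ₗ[ℂ] (Fin n₂ → ℂ)) (f₃ : (Fin m₃ → ℂ) →ₗ[ℂ] (Fin n₃ → ℂ)) :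
    Tensor3 m₁ m₂ m₃ →ₗ[ℂ] Tensor3 n₁ n₂ n₃ :=
  TensorProduct.map (TensorProduct.map f₁ f₂) f₃

/-- The orbit of `T` under `GL_{n₁} × GL_{n₂} × GL_{n₃}`. -/
def glOrbit {n₁ n₂ n₃ : ℕ} (T : Tensor3 n₁ n₂ n₃) : Set (Tensor3 n₁ n₂ n₃) :=
  {T' | ∃ (g₁ : (Fin n₁ → ℂ) ≃ₗ[ℂ] (Fin n₁ → ℂ)) (g₂ : (Fin n₂ → ℂ) ≃ₗ[ℂ] (Fin n₂ → ℂ))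
    (g₃ : (Fin n₃ → ℂ) ≃ₗ[ℂ] (Fin n₃ → ℂ)),
    T' = mapTensor g₁.toLinearMap g₂.toLinearMap g₃.toLinearMap T}

/-- `Sub_{m₁m₂m₃}` in `ℂ^{n₁} ⊗ ℂ^{n₂} ⊗ ℂ^{n₃}` (as an affine cone): the tensors lying in
`A₁ ⊗ A₂ ⊗ A₃` for some linear subspaces `A_i ≅ ℂ^{m_i}` of `ℂ^{n_i}`. The subspaces are given
as images of injective linear maps. -/
def tensorSub (m₁ m₂ m₃ : ℕ) {n₁ n₂ n₃ : ℕ} : Set (Tensor3 n₁ n₂ n₃) :=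
  {T | ∃ (f₁ : (Fin m₁ → ℂ) →ₗ[ℂ] (Fin n₁ → ℂ)) (f₂ : (Fin m₂ → ℂ) →ₗ[ℂ] (Fin n₂ → ℂ))
    (f₃ : (Fin m₃ → ℂ) →ₗ[ℂ] (Fin n₃ → ℂ)) (S : Tensor3 m₁ m₂ m₃),
    Function.Injective f₁ ∧ Function.Injective f₂ ∧ Function.Injective f₃ ∧
      T = mapTensor f₁ f₂ f₃ S}

/-- The coordinate `t_{ijk}` of a tensor in the standard basis. -/
def tensorCoord {n₁ n₂ n₃ : ℕ} (T : Tensor3 n₁ n₂ n₃) (i : Fin n₁) (j : Fin n₂) (k : Fin n₃) : ℂ :=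
  (((Pi.basisFun ℂ (Fin n₁)).tensorProduct (Pi.basisFun ℂ (Fin n₂))).tensorProduct
    (Pi.basisFun ℂ (Fin n₃))).repr T ((i, j), k)

theorem tensorCoord_pureTensor {n₁ n₂ n₃ : ℕ} (a : Fin n₁ → ℂ) (b : Fin n₂ → ℂ) (c : Fin n₃ → ℂ)
    (i : Fin n₁) (j : Fin n₂) (k : Fin n₃) :
    tensorCoord (pureTensor a b c) i j k = a i * b j * c k := by
  simp [tensorCoord, pureTensor, Module.Basis.tensorProduct_repr_tmul_apply]
  ring

/-- Cayley's hyperdeterminant `H_222` of a `2 × 2 × 2` tensor. -/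
def hyperdet222 (S : Tensor3 2 2 2) : ℂ :=
  let t := tensorCoord S
  (t 0 0 0) ^ 2 * (t 1 1 1) ^ 2 + (t 0 0 1) ^ 2 * (t 1 1 0) ^ 2
    + (t 0 1 0) ^ 2 * (t 1 0 1) ^ 2 + (t 1 0 0) ^ 2 * (t 0 1 1) ^ 2
    - 2 * (t 0 0 0 * t 0 0 1 * t 1 1 0 * t 1 1 1 + t 0 0 0 * t 0 1 0 * t 1 0 1 * t 1 1 1
      + t 0 0 0 * t 1 0 0 * t 0 1 1 * t 1 1 1 + t 0 0 1 * t 0 1 0 * t 1 0 1 * t 1 1 0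
      + t 0 0 1 * t 1 0 0 * t 0 1 1 * t 1 1 0 + t 0 1 0 * t 1 0 0 * t 0 1 1 * t 1 0 1)
    + 4 * (t 0 0 0 * t 0 1 1 * t 1 0 1 * t 1 1 0 + t 0 0 1 * t 0 1 0 * t 1 0 0 * t 1 1 1)

/-- The tensors `T ∈ Sub_222` with `H_222(T) ≠ 0`, where `H_222` is evaluated in linear coordinates
of a space `A₁ ⊗ A₂ ⊗ A₃ ≅ ℂ² ⊗ ℂ² ⊗ ℂ²` containing `T`. A different choice of spaces and
coordinates does not affect the nonvanishing. -/
def sub222HyperdetNeZero {n₁ n₂ n₃ : ℕ} : Set (Tensor3 n₁ n₂ n₃) :=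
  {T | ∃ (f₁ : (Fin 2 → ℂ) →ₗ[ℂ] (Fin n₁ → ℂ)) (f₂ : (Fin 2 → ℂ) →ₗ[ℂ] (Fin n₂ → ℂ))
    (f₃ : (Fin 2 → ℂ) →ₗ[ℂ] (Fin n₃ → ℂ)) (S : Tensor3 2 2 2),
    Function.Injective f₁ ∧ Function.Injective f₂ ∧ Function.Injective f₃ ∧
      T = mapTensor f₁ f₂ f₃ S ∧ hyperdet222 S ≠ 0}

/-- The standard basis vectors, with indices starting from `0`. -/
def stdVec {n : ℕ} (i : Fin n) : Fin n → ℂ := Pi.single i 1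

/-- `T₇ = e₁ ⊗ (e₁ ⊗ e₁ + e₂ ⊗ e₃) + e₂ ⊗ e₁ ⊗ e₂`. -/
def normalForm7 : Tensor3 2 2 3 :=
  pureTensor (stdVec 0) (stdVec 0) (stdVec 0) + pureTensor (stdVec 0) (stdVec 1) (stdVec 2)
    + pureTensor (stdVec 1) (stdVec 0) (stdVec 1)

/-- `T₈ = e₁ ⊗ (e₁ ⊗ e₁ + e₂ ⊗ e₂) + e₂ ⊗ (e₁ ⊗ e₂ + e₂ ⊗ e₃)`. -/
def normalForm8 : Tensor3 2 2 3 :=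
  pureTensor (stdVec 0) (stdVec 0) (stdVec 0) + pureTensor (stdVec 0) (stdVec 1) (stdVec 1)
    + pureTensor (stdVec 1) (stdVec 0) (stdVec 1) + pureTensor (stdVec 1) (stdVec 1) (stdVec 2)

/-- The affine cone over the section of the Segre surface
`X_22 ⊂ ℙ(ℂ² ⊗ ℂ²)` by the plane `C = 0`. For `C ≠ 0` this is a conic section of `X_22`, and
`(a, b) ↦ C (a ⊗ b)` is the `(1,1)`-form defining it. -/
def conicSection (C : Module.Dual ℂ ((Fin 2 → ℂ) ⊗[ℂ] (Fin 2 → ℂ))) :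
    Set ((Fin 2 → ℂ) ⊗[ℂ] (Fin 2 → ℂ)) :=
  {x | (∃ a b : Fin 2 → ℂ, x = a ⊗ₜ[ℂ] b) ∧ C x = 0}

/-- The affine cone over the image `ν(𝒞 × ℙ²)` for a subset `𝒞` of `X_22`, itself given by its
affine cone. -/
def segreTimesP2 (𝒞 : Set ((Fin 2 → ℂ) ⊗[ℂ] (Fin 2 → ℂ))) : Set (Tensor3 2 2 3) :=
  {T | ∃ x ∈ 𝒞, ∃ c : Fin 3 → ℂ, T = x ⊗ₜ[ℂ] c}

end

open scoped TensorProduct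

/-! Both normal forms, hence their orbits, have a decomposition into three terms with independent `a
i ⊗ b i` and independent `c i`. Contracting `T` with forms on the first two factors then reaches all
of `ℂ³`, so the third vectors of any decomposition span `ℂ³`: the rank is 3, and in every three-term
decomposition they form a basis (`span_eq_top_of_decomposition`).

If `T` lies over the conic `C = 0`, contraction with `C` kills `T`; by that independence `C`
vanishes on the matrix part of each term of every three-term decomposition.

It remains to recognise two-term residues `T - λP`. Their third vectors are independent, so they lie
in one of the stated loci according to whether the first and second vectors are independent
(`mem_of_hasDecomposition_two`). Conversely, tensors in these loci have rank at most 2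
(`hasDecomposition_two_of_mem`), the main case being a pencil of 2×2 matrices with two distinct
singular members. -/

/-- `T` is a sum of `r` tensors `a ⊗ b ⊗ c`. -/
def HasDecomposition {n₁ n₂ n₃ : ℕ} (r : ℕ) (T : Tensor3 n₁ n₂ n₃) : Prop :=
  ∃ (a : Fin r → Fin n₁ → ℂ) (b : Fin r → Fin n₂ → ℂ) (c : Fin r → Fin n₃ → ℂ),
    T = ∑ i, pureTensor (a i) (b i) (c i)

theorem tensorRank_le {n₁ n₂ n₃ r : ℕ} {T : Tensor3 n₁ n₂ n₃} (h : HasDecomposition r T) :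
    tensorRank T ≤ r :=
  Nat.sInf_le h

/-- The infimum of the empty set is 0, so a lower bound requires that some decomposition exists. -/
theorem le_tensorRank {n₁ n₂ n₃ r s : ℕ} {T : Tensor3 n₁ n₂ n₃} (hs : HasDecomposition s T)
    (h : ∀ k, HasDecomposition k T → r ≤ k) : r ≤ tensorRank T :=
  h _ (Nat.sInf_mem (s := {r | HasDecomposition r T}) ⟨s, hs⟩)

theorem hasDecomposition_tensorRank {n₁ n₂ n₃ : ℕ} {T : Tensor3 n₁ n₂ n₃} (h : 0 < tensorRank T) :
    HasDecomposition (tensorRank T) T :=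
  Nat.sInf_mem (s := {r | HasDecomposition r T}) (Nat.nonempty_of_pos_sInf h)

theorem mapTensor_pureTensor {m₁ m₂ m₃ n₁ n₂ n₃ : ℕ} (f₁ : (Fin m₁ → ℂ) →ₗ[ℂ] (Fin n₁ → ℂ))
    (f₂ : (Fin m₂ → ℂ) →ₗ[ℂ] (Fin n₂ → ℂ)) (f₃ : (Fin m₃ → ℂ) →ₗ[ℂ] (Fin n₃ → ℂ))
    (a : Fin m₁ → ℂ) (b : Fin m₂ → ℂ) (c : Fin m₃ → ℂ) :
    mapTensor f₁ f₂ f₃ (pureTensor a b c) = pureTensor (f₁ a) (f₂ b) (f₃ c) := by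
  simp [mapTensor, pureTensor]

theorem smul_pureTensor {n₁ n₂ n₃ : ℕ} (l : ℂ) (a : Fin n₁ → ℂ) (b : Fin n₂ → ℂ)
    (c : Fin n₃ → ℂ) : l • pureTensor a b c = pureTensor (l • a) b c := by
  simp [pureTensor, TensorProduct.smul_tmul']

theorem HasDecomposition.map {m₁ m₂ m₃ n₁ n₂ n₃ r : ℕ} {S : Tensor3 m₁ m₂ m₃}
    (h : HasDecomposition r S) (f₁ : (Fin m₁ → ℂ) →ₗ[ℂ] (Fin n₁ → ℂ))
    (f₂ : (Fin m₂ → ℂ) →ₗ[ℂ] (Fin n₂ → ℂ)) (f₃ : (Fin m₃ → ℂ) →ₗ[ℂ] (Fin n₃ → ℂ)) :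
    HasDecomposition r (mapTensor f₁ f₂ f₃ S) := by
  obtain ⟨a, b, c, rfl⟩ := h
  exact ⟨fun i => f₁ (a i), fun i => f₂ (b i), fun i => f₃ (c i), by
    simp [map_sum, mapTensor_pureTensor]⟩

theorem HasDecomposition.of_sub {n₁ n₂ n₃ r : ℕ} {T : Tensor3 n₁ n₂ n₃} {l : ℂ}
    {a : Fin n₁ → ℂ} {b : Fin n₂ → ℂ} {c : Fin n₃ → ℂ}
    (h : HasDecomposition r (T - l • pureTensor a b c)) : HasDecomposition (r + 1) T := by
  obtain ⟨a', b', c', h⟩ := h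
  refine ⟨Fin.cons (l • a) a', Fin.cons b b', Fin.cons c c', ?_⟩
  rw [Fin.sum_univ_succ]
  simp only [Fin.cons_zero, Fin.cons_succ]
  rw [← h, ← smul_pureTensor]
  abel

/-! ### Contractions and conciseness in the third factor -/

/-- Contraction of the first two factors with a linear form. -/
def contract {n₁ n₂ n₃ : ℕ} (φ : Module.Dual ℂ ((Fin n₁ → ℂ) ⊗[ℂ] (Fin n₂ → ℂ))) :
    Tensor3 n₁ n₂ n₃ →ₗ[ℂ] (Fin n₃ → ℂ) :=
  TensorProduct.lift ((LinearMap.lsmul ℂ (Fin n₃ → ℂ)).comp φ)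

theorem contract_tmul {n₁ n₂ n₃ : ℕ} (φ : Module.Dual ℂ ((Fin n₁ → ℂ) ⊗[ℂ] (Fin n₂ → ℂ)))
    (x : (Fin n₁ → ℂ) ⊗[ℂ] (Fin n₂ → ℂ)) (c : Fin n₃ → ℂ) :
    contract φ (x ⊗ₜ[ℂ] c) = φ x • c := by
  simp [contract]

theorem contract_pureTensor {n₁ n₂ n₃ : ℕ}
    (φ : Module.Dual ℂ ((Fin n₁ → ℂ) ⊗[ℂ] (Fin n₂ → ℂ)))
    (a : Fin n₁ → ℂ) (b : Fin n₂ → ℂ) (c : Fin n₃ → ℂ) :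
    contract φ (pureTensor a b c) = φ (a ⊗ₜ[ℂ] b) • c :=
  contract_tmul φ _ c

theorem exists_dual_eq_one {V ι : Type*} [AddCommGroup V] [Module ℂ V] [DecidableEq ι] {x : ι → V}
    (hx : LinearIndependent ℂ x) (i : ι) :
    ∃ φ : Module.Dual ℂ V, ∀ j, φ (x j) = if j = i then 1 else 0 := by
  classical
  refine ⟨(Module.Basis.extend hx.linearIndepOn_id).constr ℂ
    (fun v => if (v : V) = x i then (1 : ℂ) else 0), fun j => ?_⟩
  have hm : x j ∈ hx.linearIndepOn_id.extend (Set.subset_univ _) :=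
    hx.linearIndepOn_id.subset_extend _ ⟨j, rfl⟩
  have := (Module.Basis.extend hx.linearIndepOn_id).constr_basis ℂ
    (fun v => if (v : V) = x i then (1 : ℂ) else 0) ⟨x j, hm⟩
  rw [Module.Basis.extend_apply_self] at this
  simpa [hx.injective.eq_iff] using this

section Concise

variable {T : Tensor3 2 2 3} {a b : Fin 3 → Fin 2 → ℂ} {c : Fin 3 → Fin 3 → ℂ}

/-- In any decomposition of a tensor concise in the third factor, the third vectors span. -/
theorem span_eq_top_of_decomposition (hx : LinearIndependent ℂ fun i => a i ⊗ₜ[ℂ] b i)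
    (hc : LinearIndependent ℂ c) (hT : T = ∑ i, pureTensor (a i) (b i) (c i)) {r : ℕ}
    {a' b' : Fin r → Fin 2 → ℂ} {c' : Fin r → Fin 3 → ℂ}
    (h : T = ∑ i, pureTensor (a' i) (b' i) (c' i)) :
    ⊤ ≤ Submodule.span ℂ (Set.range c') := by
  rw [← hc.span_eq_top_of_card_eq_finrank' (by simp), Submodule.span_le]
  rintro _ ⟨i, rfl⟩
  -- A form dual to the `i`-th matrix part extracts `c i` from `T`.
  obtain ⟨φ, hφ⟩ := exists_dual_eq_one hx i
  have e : contract φ T = c i := by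
    simp [hT, map_sum, contract_pureTensor, hφ]
  rw [← e, h]
  simp only [map_sum, contract_pureTensor]
  exact Submodule.sum_mem _ fun j _ => Submodule.smul_mem _ _ (Submodule.subset_span ⟨j, rfl⟩)

theorem three_le_of_hasDecomposition (hx : LinearIndependent ℂ fun i => a i ⊗ₜ[ℂ] b i)
    (hc : LinearIndependent ℂ c) (hT : T = ∑ i, pureTensor (a i) (b i) (c i)) {r : ℕ}
    (h : HasDecomposition r T) : 3 ≤ r := by
  obtain ⟨a', b', c', h⟩ := h
  have := finrank_range_le_card (R := ℂ) c'
  rw [Set.finrank, top_le_iff.mp (span_eq_top_of_decomposition hx hc hT h)] at this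
  simpa using this

theorem tensorRank_eq_three (hx : LinearIndependent ℂ fun i => a i ⊗ₜ[ℂ] b i)
    (hc : LinearIndependent ℂ c) (hT : T = ∑ i, pureTensor (a i) (b i) (c i)) :
    tensorRank T = 3 :=
  have h : HasDecomposition 3 T := ⟨a, b, c, hT⟩
  le_antisymm (tensorRank_le h) (le_tensorRank h fun _ => three_le_of_hasDecomposition hx hc hT)

end Concise

theorem contract_eq_zero_of_mem_span {C : Module.Dual ℂ ((Fin 2 → ℂ) ⊗[ℂ] (Fin 2 → ℂ))}
    {T : Tensor3 2 2 3} (h : T ∈ Submodule.span ℂ (segreTimesP2 (conicSection C))) :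
    contract C T = 0 := by
  have : Submodule.span ℂ (segreTimesP2 (conicSection C)) ≤ LinearMap.ker (contract C) := by
    rw [Submodule.span_le]
    rintro _ ⟨x, hx, c, rfl⟩
    simp [contract_tmul, hx.2]
  exact this h

/-! ### Tensors that are sums of two decomposable tensors -/

theorem sum_tensorCoord {n₁ n₂ n₃ : ℕ} (S : Tensor3 n₁ n₂ n₃) :
    S = ∑ i, ∑ j, ∑ k, tensorCoord S i j k • pureTensor (stdVec i) (stdVec j) (stdVec k) := by
  conv_lhs => rw [← (((Pi.basisFun ℂ (Fin n₁)).tensorProduct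
    (Pi.basisFun ℂ (Fin n₂))).tensorProduct (Pi.basisFun ℂ (Fin n₃))).sum_repr S]
  simp only [Fintype.sum_prod_type, Module.Basis.tensorProduct_apply, Pi.basisFun_apply]
  rfl

theorem tensorCoord_ext {n₁ n₂ n₃ : ℕ} {S S' : Tensor3 n₁ n₂ n₃}
    (h : ∀ i j k, tensorCoord S i j k = tensorCoord S' i j k) : S = S' := by
  rw [sum_tensorCoord S, sum_tensorCoord S']
  simp only [h]

theorem tensorCoord_add {n₁ n₂ n₃ : ℕ} (S S' : Tensor3 n₁ n₂ n₃) (i : Fin n₁) (j : Fin n₂)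
    (k : Fin n₃) : tensorCoord (S + S') i j k = tensorCoord S i j k + tensorCoord S' i j k := by
  simp [tensorCoord]

theorem hasDecomposition_of_fin_one_left (S : Tensor3 1 2 2) : HasDecomposition 2 S := by
  refine ⟨fun _ => stdVec 0, fun j => stdVec j, fun j => fun k => tensorCoord S 0 j k, ?_⟩
  refine tensorCoord_ext fun i j k => ?_
  fin_cases i
  fin_cases j <;>
    simp [Fin.sum_univ_two, tensorCoord_add, tensorCoord_pureTensor, stdVec]

theorem hasDecomposition_of_fin_one_middle (S : Tensor3 2 1 2) : HasDecomposition 2 S := by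
  refine ⟨fun i => stdVec i, fun _ => stdVec 0, fun i => fun k => tensorCoord S i 0 k, ?_⟩
  refine tensorCoord_ext fun i j k => ?_
  fin_cases i <;> fin_cases j <;>
    simp [Fin.sum_univ_two, tensorCoord_add, tensorCoord_pureTensor, stdVec]

theorem exists_eq_mul_of_det_eq_zero {m : Fin 2 → Fin 2 → ℂ}
    (h : m 0 0 * m 1 1 - m 0 1 * m 1 0 = 0) :
    ∃ a b : Fin 2 → ℂ, ∀ i j, m i j = a i * b j := by
  by_cases h0 : m 0 0 = 0
  · by_cases h1 : m 0 1 = 0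
    · exact ⟨![0, 1], m 1, by simp [Fin.forall_fin_two, h0, h1]⟩
    · refine ⟨![1, m 1 1 / m 0 1], m 0, ?_⟩
      have : m 1 0 = 0 := by simpa [h0, h1] using h
      simp [Fin.forall_fin_two, this, h0, h1]
  · refine ⟨![1, m 1 0 / m 0 0], m 0, ?_⟩
    simp only [Fin.forall_fin_two]
    simp [h0]
    field_simp
    linear_combination h

/-- A binary quadratic form with nonzero discriminant has two independent zeros. -/
theorem exists_independent_zeros {p q r : ℂ} (h : q ^ 2 - 4 * p * r ≠ 0) :
    ∃ x y z w : ℂ, p * x ^ 2 + q * x * y + r * y ^ 2 = 0 ∧ p * z ^ 2 + q * z * w + r * w ^ 2 = 0 ∧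
      x * w - y * z = 1 := by
  have key : ∃ x y z w : ℂ, p * x ^ 2 + q * x * y + r * y ^ 2 = 0 ∧
      p * z ^ 2 + q * z * w + r * w ^ 2 = 0 ∧ x * w - y * z ≠ 0 := by
    by_cases hp : p = 0
    · subst hp
      exact ⟨1, 0, r, -q, by ring, by ring, by simpa using h⟩
    · obtain ⟨s, hs⟩ := IsAlgClosed.exists_pow_nat_eq (q ^ 2 - 4 * p * r) (n := 2) (by norm_num)
      have hs0 : s ≠ 0 := by rintro rfl; exact h (by rw [← hs]; ring)
      -- The quadratic formula in homogeneous coordinates.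
      refine ⟨-q + s, 2 * p, -q - s, 2 * p, ?_, ?_, ?_⟩
      · linear_combination p * hs
      · linear_combination p * hs
      · have : (-q + s) * (2 * p) - 2 * p * (-q - s) = 4 * (p * s) := by ring
        rw [this]
        simp [hp, hs0]
  obtain ⟨x, y, z, w, h1, h2, h3⟩ := key
  refine ⟨x / (x * w - y * z), y / (x * w - y * z), z, w, ?_, h2, ?_⟩
  · have : p * (x / (x * w - y * z)) ^ 2 + q * (x / (x * w - y * z)) * (y / (x * w - y * z))
        + r * (y / (x * w - y * z)) ^ 2
        = (p * x ^ 2 + q * x * y + r * y ^ 2) / (x * w - y * z) ^ 2 := by field_simp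
    rw [this, h1, zero_div]
  · have : x / (x * w - y * z) * w - y / (x * w - y * z) * z
        = (x * w - y * z) / (x * w - y * z) := by ring
    rw [this, div_self h3]

/-- The hyperdeterminant is the discriminant of `det (x M₀ + y M₁)`, where `M₀`, `M₁` are the slices
in the third index. When it is nonzero, the pencil has a basis of singular matrices, each of the
form `a i * b j`. -/
theorem hasDecomposition_of_hyperdet_ne_zero {S : Tensor3 2 2 2} (h : hyperdet222 S ≠ 0) :
    HasDecomposition 2 S := by
  set t := tensorCoord S with ht
  obtain ⟨x, y, z, w, h1, h2, h3⟩ := exists_independent_zeros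
    (p := t 0 0 0 * t 1 1 0 - t 0 1 0 * t 1 0 0)
    (q := t 0 0 0 * t 1 1 1 + t 0 0 1 * t 1 1 0 - t 0 1 0 * t 1 0 1 - t 0 1 1 * t 1 0 0)
    (r := t 0 0 1 * t 1 1 1 - t 0 1 1 * t 1 0 1) (by
      refine fun e => h ?_
      simp only [hyperdet222, ← ht]
      linear_combination e)
  obtain ⟨a, b, hab⟩ := exists_eq_mul_of_det_eq_zero
    (m := fun i j => x * t i j 0 + y * t i j 1) (by linear_combination h1)
  obtain ⟨a', b', hab'⟩ := exists_eq_mul_of_det_eq_zero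
    (m := fun i j => z * t i j 0 + w * t i j 1) (by linear_combination h2)
  -- The third vectors come from inverting the change of basis of determinant 1: `M₀ = w M - y M'`
  -- and `M₁ = -z M + x M'`.
  refine ⟨![a, a'], ![b, b'], ![![w, -z], ![-y, x]], tensorCoord_ext fun i j k => ?_⟩
  simp only [Fin.sum_univ_two, tensorCoord_add, tensorCoord_pureTensor, Matrix.cons_val_zero,
    Matrix.cons_val_one, ← hab, ← hab', ← ht]
  fin_cases k
  · simp only [Fin.zero_eta, Matrix.cons_val_zero]
    linear_combination (-t i j 0) * h3
  · simp only [Fin.mk_one, Matrix.cons_val_one, Matrix.cons_val_zero]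
    linear_combination (-t i j 1) * h3

theorem linearCombination_injective {n m : ℕ} {v : Fin m → Fin n → ℂ} (hv : LinearIndependent ℂ v) :
    Function.Injective (Fintype.linearCombination ℂ v) :=
  hv.fintypeLinearCombination_injective

theorem linearCombination_stdVec {n m : ℕ} (v : Fin m → Fin n → ℂ) (i : Fin m) :
    Fintype.linearCombination ℂ v (stdVec i) = v i := by
  simp [stdVec, Fintype.linearCombination_apply_single]

/-- The vector `u` is kept nonzero even when both `v i` vanish, so that it spans a genuine line, as
`tensorSub` demands. -/
theorem exists_common_multiple {v : Fin 2 → Fin 2 → ℂ} (hv : ¬ LinearIndependent ℂ v) :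
    ∃ u : Fin 2 → ℂ, u ≠ 0 ∧ ∃ s : Fin 2 → ℂ, ∀ i, v i = s i • u := by
  by_cases h0 : v 1 = 0
  · by_cases h1 : v 0 = 0
    · exact ⟨stdVec 0, fun h => by simpa [stdVec] using congrFun h 0, 0, by
        simp [Fin.forall_fin_two, h0, h1]⟩
    · exact ⟨v 0, h1, ![1, 0], by simp [Fin.forall_fin_two, h0]⟩
  · have : ∃ t : ℂ, t • v 1 = v 0 := by
      by_contra hne
      push Not at hne
      refine hv ?_
      have := (LinearIndependent.pair_iff' (K := ℂ) h0 (y := v 0)).2 hne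
      rw [← LinearIndependent.pair_symm_iff] at this
      have e : v = ![v 0, v 1] := by
        ext i
        fin_cases i <;> rfl
      rwa [e]
    obtain ⟨t, ht⟩ := this
    exact ⟨v 1, h0, ![t, 1], by simp [Fin.forall_fin_two, ht]⟩

theorem linearCombination_const_injective {u : Fin 2 → ℂ} (hu : u ≠ 0) :
    Function.Injective (Fintype.linearCombination ℂ fun _ : Fin 1 => u) :=
  linearCombination_injective (LinearIndependent.of_subsingleton 0 hu)

theorem mem_of_hasDecomposition_two {T : Tensor3 2 2 3} {a b : Fin 2 → Fin 2 → ℂ}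
    {c : Fin 2 → Fin 3 → ℂ} (hc : LinearIndependent ℂ c)
    (hT : T = ∑ i, pureTensor (a i) (b i) (c i)) :
    T ∈ sub222HyperdetNeZero ∨ T ∈ tensorSub 1 2 2 ∪ tensorSub 2 1 2 := by
  by_cases ha : LinearIndependent ℂ a
  · by_cases hb : LinearIndependent ℂ b
    -- The tensor is an injective image of the diagonal tensor, whose hyperdeterminant is 1.
    · refine Or.inl ⟨_, _, _, ∑ i, pureTensor (stdVec i) (stdVec i) (stdVec i),
        linearCombination_injective ha, linearCombination_injective hb, linearCombination_injective hc, ?_, ?_⟩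
      · simp only [hT, map_sum, mapTensor_pureTensor, linearCombination_stdVec]
      · simp [hyperdet222, Fin.sum_univ_two, tensorCoord_add, tensorCoord_pureTensor, stdVec]
    · obtain ⟨u, hu, s, hs⟩ := exists_common_multiple hb
      refine Or.inr (Or.inr ⟨_, _, _, ∑ i, pureTensor (stdVec i) (fun _ => s i) (stdVec i),
        linearCombination_injective ha, linearCombination_const_injective hu, linearCombination_injective hc, ?_⟩)
      simp only [hT, map_sum, mapTensor_pureTensor, linearCombination_stdVec]
      simp [Fintype.linearCombination_apply, hs]
  · obtain ⟨u, hu, s, hs⟩ := exists_common_multiple ha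
    refine Or.inr (Or.inl ⟨_, LinearMap.id, _, ∑ i, pureTensor (fun _ => s i) (b i) (stdVec i),
      linearCombination_const_injective hu, Function.injective_id, linearCombination_injective hc, ?_⟩)
    simp only [hT, map_sum, mapTensor_pureTensor, linearCombination_stdVec]
    simp [Fintype.linearCombination_apply, hs]

theorem hasDecomposition_two_of_mem {T : Tensor3 2 2 3}
    (h : T ∈ sub222HyperdetNeZero ∨ T ∈ tensorSub 1 2 2 ∪ tensorSub 2 1 2) :
    HasDecomposition 2 T := by
  rcases h with ⟨f₁, f₂, f₃, S, -, -, -, rfl, hS⟩ | ⟨f₁, f₂, f₃, S, -, -, -, rfl⟩ |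
    ⟨f₁, f₂, f₃, S, -, -, -, rfl⟩
  · exact (hasDecomposition_of_hyperdet_ne_zero hS).map ..
  · exact (hasDecomposition_of_fin_one_left S).map ..
  · exact (hasDecomposition_of_fin_one_middle S).map ..

/-! ### Concise decompositions of the two orbits -/

/-- A decomposition of `T` into three terms with independent matrix parts and independent third
vectors. -/
def HasConciseDecomposition (T : Tensor3 2 2 3) : Prop :=
  ∃ (a b : Fin 3 → Fin 2 → ℂ) (c : Fin 3 → Fin 3 → ℂ),
    LinearIndependent ℂ (fun i => a i ⊗ₜ[ℂ] b i) ∧ LinearIndependent ℂ c ∧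
      T = ∑ i, pureTensor (a i) (b i) (c i)

theorem HasConciseDecomposition.of_mem_glOrbit {S T : Tensor3 2 2 3}
    (hS : HasConciseDecomposition S) (hT : T ∈ glOrbit S) : HasConciseDecomposition T := by
  obtain ⟨a, b, c, hx, hc, rfl⟩ := hS
  obtain ⟨g₁, g₂, g₃, rfl⟩ := hT
  refine ⟨fun i => g₁ (a i), fun i => g₂ (b i), fun i => g₃ (c i), ?_,
    hc.map' g₃.toLinearMap g₃.ker, by simp [map_sum, mapTensor_pureTensor]⟩
  exact hx.map' (TensorProduct.congr g₁ g₂).toLinearMap (TensorProduct.congr g₁ g₂).ker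

theorem linearIndependent_tmul_of_coord {a b : Fin 3 → Fin 2 → ℂ}
    (h : ∀ g : Fin 3 → ℂ, (∀ i j, ∑ k, g k * (a k i * b k j) = 0) → ∀ k, g k = 0) :
    LinearIndependent ℂ fun i => a i ⊗ₜ[ℂ] b i := by
  rw [Fintype.linearIndependent_iff]
  refine fun g hg => h g fun i j => ?_
  have := congrArg (fun x => ((Pi.basisFun ℂ (Fin 2)).tensorProduct
    (Pi.basisFun ℂ (Fin 2))).repr x (i, j)) hg
  simpa [Module.Basis.tensorProduct_repr_tmul_apply, mul_comm (b _ _)] using this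

theorem hasConciseDecomposition_normalForm7 : HasConciseDecomposition normalForm7 := by
  refine ⟨![stdVec 0, stdVec 0, stdVec 1], ![stdVec 0, stdVec 1, stdVec 0],
    ![stdVec 0, stdVec 2, stdVec 1], linearIndependent_tmul_of_coord fun g hg => ?_, ?_, ?_⟩
  · simp [Fin.sum_univ_three, stdVec, Fin.forall_fin_succ] at hg ⊢
    tauto
  · rw [Fintype.linearIndependent_iff]
    intro g hg
    have h0 := congrFun hg 0
    have h1 := congrFun hg 1
    have h2 := congrFun hg 2
    simp [Fin.sum_univ_three, stdVec, Fin.forall_fin_succ] at h0 h1 h2 ⊢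
    tauto
  · simp [normalForm7, Fin.sum_univ_three]

theorem hasConciseDecomposition_normalForm8 : HasConciseDecomposition normalForm8 := by
  -- Polarization: `e₁ ⊗ e₂ + e₂ ⊗ e₁ = (e₁ + e₂) ⊗ (e₁ + e₂) - e₁ ⊗ e₁ - e₂ ⊗ e₂`.
  refine ⟨![stdVec 0, stdVec 0 + stdVec 1, stdVec 1], ![stdVec 0, stdVec 0 + stdVec 1, stdVec 1],
    ![stdVec 0 - stdVec 1, stdVec 1, stdVec 2 - stdVec 1],
    linearIndependent_tmul_of_coord fun g hg => ?_, ?_, ?_⟩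
  · simp [Fin.sum_univ_three, stdVec, Fin.forall_fin_succ] at hg ⊢
    grind
  · rw [Fintype.linearIndependent_iff]
    intro g hg
    have h0 := congrFun hg 0
    have h1 := congrFun hg 1
    have h2 := congrFun hg 2
    simp [Fin.sum_univ_three, stdVec, Fin.forall_fin_succ] at h0 h1 h2 ⊢
    grind
  · simp only [normalForm8, Fin.sum_univ_three, pureTensor, Matrix.cons_val, TensorProduct.add_tmul,
      TensorProduct.tmul_add, TensorProduct.tmul_sub]
    abel

/-! ### The conic and the decomposition locus -/

/-- Three matrix parts cannot span the four-dimensional space `ℂ² ⊗ ℂ²`, so a nonzero form vanishes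
on them. -/
theorem HasConciseDecomposition.exists_conicSection {T : Tensor3 2 2 3}
    (hT : HasConciseDecomposition T) : ∃ C : Module.Dual ℂ ((Fin 2 → ℂ) ⊗[ℂ] (Fin 2 → ℂ)),
      C ≠ 0 ∧ T ∈ Submodule.span ℂ (segreTimesP2 (conicSection C)) := by
  obtain ⟨a, b, c, -, -, rfl⟩ := hT
  set W := Submodule.span ℂ (Set.range fun i => a i ⊗ₜ[ℂ] b i)
  have hW : W < ⊤ := by
    rw [lt_top_iff_ne_top]
    intro h
    have := finrank_range_le_card (R := ℂ) fun i => a i ⊗ₜ[ℂ] b i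
    rw [Set.finrank, show Submodule.span ℂ _ = ⊤ from h, finrank_top, Module.finrank_tensorProduct] at this
    simp at this
  obtain ⟨C, hC, hWC⟩ := Submodule.exists_le_ker_of_lt_top W hW
  refine ⟨C, hC, Submodule.sum_mem _ fun i _ => Submodule.subset_span ?_⟩
  exact ⟨_, ⟨⟨a i, b i, rfl⟩, hWC (Submodule.subset_span ⟨i, rfl⟩)⟩, c i, rfl⟩

theorem HasConciseDecomposition.mem_decompositionLocus_iff {T : Tensor3 2 2 3}
    (hT : HasConciseDecomposition T) {C : Module.Dual ℂ ((Fin 2 → ℂ) ⊗[ℂ] (Fin 2 → ℂ))}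
    (hTC : T ∈ Submodule.span ℂ (segreTimesP2 (conicSection C)))
    (p : (Fin 2 → ℂ) × (Fin 2 → ℂ) × (Fin 3 → ℂ)) :
    p ∈ decompositionLocus T ↔ C (p.1 ⊗ₜ[ℂ] p.2.1) = 0 ∧ ∃ l : ℂ,
      T - l • pureTensor p.1 p.2.1 p.2.2 ∈ sub222HyperdetNeZero ∨
      T - l • pureTensor p.1 p.2.1 p.2.2 ∈ tensorSub 1 2 2 ∪ tensorSub 2 1 2 := by
  obtain ⟨a, b, c, hx, hc, hsum⟩ := hT
  have hrank := tensorRank_eq_three hx hc hsum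
  obtain ⟨u, v, w⟩ := p
  have residue {l : ℂ} (h : HasDecomposition 2 (T - l • pureTensor u v w)) :
      C (u ⊗ₜ[ℂ] v) = 0 ∧ (T - l • pureTensor u v w ∈ sub222HyperdetNeZero ∨
        T - l • pureTensor u v w ∈ tensorSub 1 2 2 ∪ tensorSub 2 1 2) := by
    -- With `l = 0` the tensor `T` itself would have only two terms.
    have hl : l ≠ 0 := by
      rintro rfl
      have := three_le_of_hasDecomposition hx hc hsum (r := 2)
        (by rwa [zero_smul, show T - 0 = T from sub_zero T] at h)
      omega
    obtain ⟨a', b', c', h⟩ := h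
    have hdec : T = ∑ i : Fin 3, pureTensor ((Fin.cons (l • u) a' : Fin 3 → Fin 2 → ℂ) i)
        ((Fin.cons v b' : Fin 3 → Fin 2 → ℂ) i) ((Fin.cons w c' : Fin 3 → Fin 3 → ℂ) i) := by
      rw [Fin.sum_univ_succ]
      simp only [Fin.cons_zero, Fin.cons_succ]
      rw [← h, ← smul_pureTensor]
      abel
    have hind := linearIndependent_of_top_le_span_of_card_eq_finrank
      (span_eq_top_of_decomposition hx hc hsum hdec) (by simp)
    refine ⟨?_, mem_of_hasDecomposition_two (linearIndependent_finCons.1 hind).1 h⟩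
    -- Contraction with `C` gives a linear relation among the independent third vectors; its
    -- coefficient at `w` is `l * C (u ⊗ v)`.
    have hz := contract_eq_zero_of_mem_span hTC
    rw [hdec] at hz
    simp only [map_sum, contract_pureTensor] at hz
    have := Fintype.linearIndependent_iff.1 hind _ hz 0
    rw [Fin.cons_zero, Fin.cons_zero, ← TensorProduct.smul_tmul', map_smul, smul_eq_mul] at this
    exact (mul_eq_zero.1 this).resolve_left hl
  constructor
  · rintro ⟨l, hl⟩
    dsimp only at hl ⊢
    have h2 : tensorRank (T - l • pureTensor u v w) = 2 := by omega
    have := hasDecomposition_tensorRank (T := T - l • pureTensor u v w) (by omega)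
    rw [h2] at this
    exact ⟨(residue this).1, l, (residue this).2⟩
  · rintro ⟨-, l, h⟩
    have h2 := hasDecomposition_two_of_mem h
    refine ⟨l, ?_⟩
    rw [hrank, Nat.succ_inj (b := 2)]
    refine le_antisymm (tensorRank_le h2) (le_tensorRank h2 fun k hk => ?_)
    -- Restoring the removed term to a `k`-term residue decomposes `T` into `k + 1` terms.
    have := three_le_of_hasDecomposition hx hc hsum hk.of_sub
    omega

theorem mainTheorem5 (T : Tensor3 2 2 3)
    (hT : T ∈ glOrbit normalForm7 ∪ glOrbit normalForm8) :
    (∃ C : Module.Dual ℂ ((Fin 2 → ℂ) ⊗[ℂ] (Fin 2 → ℂ)),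
      C ≠ 0 ∧ T ∈ Submodule.span ℂ (segreTimesP2 (conicSection C))) ∧
    ∀ C : Module.Dual ℂ ((Fin 2 → ℂ) ⊗[ℂ] (Fin 2 → ℂ)),
      C ≠ 0 → T ∈ Submodule.span ℂ (segreTimesP2 (conicSection C)) →
        decompositionLocus T =
          {p | C (p.1 ⊗ₜ[ℂ] p.2.1) = 0 ∧
            ∃ l : ℂ,
              T - l • pureTensor p.1 p.2.1 p.2.2 ∈ sub222HyperdetNeZero ∨
              T - l • pureTensor p.1 p.2.1 p.2.2 ∈ tensorSub 1 2 2 ∪ tensorSub 2 1 2} := by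
  have h : HasConciseDecomposition T := hT.elim
    hasConciseDecomposition_normalForm7.of_mem_glOrbit
    hasConciseDecomposition_normalForm8.of_mem_glOrbit
  exact ⟨h.exists_conicSection, fun C _ hTC => Set.ext (h.mem_decompositionLocus_iff hTC)⟩
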